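/- Let $k$ be a field, let $r\ge 1$ and $n_1,\dots,n_r\ge 0$ be integers, and let $R=k[x_{i,j} : 1\le i\le r,\ 0\le j\le n_i]$ be the coordinate ring of $\mathbb{P}^{n_1}\times\cdots\times\mathbb{P}^{n_r}$ over $k$. Let $0\le s\le\min\{n_1,\dots,n_r\}$, let $P_0,\dots,P_s$ be distinct ($k$-rational) points of $\mathbb{P}^{n_1}\times\cdots\times\mathbb{P}^{n_r}$ and let $a_0,\dots,a_s$ be positive integers. Assume that $P_0,\dots,P_s$ are in linear general position: for all linear subspaces $\mathcal{L}_i\subseteq\mathbb{P}^{n_i}$ of dimensions $d_i\in\{0,\dots,n_i\}$, with $d_j<n_j$ for at least one $j$, the product $\mathcal{L}_1\times\cdots\times\mathcal{L}_r$ contains at most $\min\{d_1,\dots,d_r\}+1$ of the points. Let $$I=I_{P_0}^{a_0}\cap\cdots\cap I_{P_s}^{a_s}\subseteq R,$$ where the defining ideal $I_P$ of a point $P=(p_1,\dots,p_r)$ is generated, over all $i$, by the forms in $x_{i,0},\dots,x_{i,n_i}$ that vanish at $p_i$. Give $R$ the standard grading, and for $d\ge 0$ let $(I_d)$ be the ideal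 generated by all forms of degree $d$ in $I$. Then: 1. There are invertible linear changes of coordinates, one in each factor $\mathbb{P}^{n_i}$, which carry $P_0,\dots,P_s$ to coordinate vertices (the $i$-th component of $P_t$ to the $t$-th coordinate vertex of $\mathbb{P}^{n_i}$), such that in the new coordinates $(I_d)$ is a polymatroidal ideal for every $d$. That is, $(I_d)$ is a monomial ideal generated in a single degree (possibly the zero ideal), and for any two of its minimal monomial generators $u=\prod_v x_v^{e_v}$ and $w=\prod_v x_v^{f_v}$ and each $v$ with $e_v>f_v$ there is $v'$ with $e_{v'}<f_{v'}$ and $x_{v'}u/x_v\in(I_d)$. 2. $I$ is componentwise linear: $I$ is homogeneous and, for every $d$, the ideal $(I_d)$ has a linear resolution, i.e. its minimal graded free resolution has graded Betti numbers $\beta_{i,j}((I_d))=0$ whenever $j\ne i+d$. -/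

import Mathlib

namespace FatPoints

section Resolutions

open MvPolynomial

variable {σ k : Type*} [Field k]

/-- The ideal `(I_d)` generated by all forms of degree `d` lying in `I`
(every variable has degree one). -/
noncomputable def component (I : Ideal (MvPolynomial σ k)) (d : ℕ) : Ideal (MvPolynomial σ k) :=
  Ideal.span {f | f ∈ I ∧ f.IsHomogeneous d}

/-- A minimal graded free resolution of finite length
`0 → F_h → ⋯ → F_1 → F_0 → I → 0` of an ideal `I` of `R = k[x_v : v ∈ σ]`, where
`F_i = ⨁_a R(-shift i a)`.  The basis vector `e_a` of `F_i` has degree `shift i a`, and all the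
maps are homogeneous of degree zero. -/
structure MinimalGradedFreeResolution (I : Ideal (MvPolynomial σ k)) where
  /-- the rank of `F_i` -/
  rank : ℕ → ℕ
  /-- the degrees of the basis vectors of `F_i` -/
  shift : ∀ i, Fin (rank i) → ℕ
  /-- the resolution has finite length -/
  finite_length : ∃ h, ∀ i, h < i → rank i = 0
  /-- the augmentation `F_0 → R`, with image `I` -/
  aug : (Fin (rank 0) → MvPolynomial σ k) →ₗ[MvPolynomial σ k] MvPolynomial σ k
  /-- the differentials `F_{i+1} → F_i` -/
  diff : ∀ i, (Fin (rank (i + 1)) → MvPolynomial σ k) →ₗ[MvPolynomial σ k]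
    (Fin (rank i) → MvPolynomial σ k)
  /-- the augmentation is homogeneous of degree zero -/
  aug_homogeneous : ∀ a, (aug (Pi.single a 1)).IsHomogeneous (shift 0 a)
  /-- the differentials are homogeneous of degree zero: the coefficient of `e_a` in the image of
  `e_b` is a form of degree `shift (i + 1) b - shift i a` (and zero if this is negative) -/
  diff_homogeneous : ∀ i a b, diff i (Pi.single b 1) a = 0 ∨
    ∃ m, m + shift i a = shift (i + 1) b ∧ (diff i (Pi.single b 1) a).IsHomogeneous m
  /-- minimality: the entries of the differentials lie in the ideal generated by the variables -/
  minimal : ∀ i a b, diff i (Pi.single b 1) a ∈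
    Ideal.span (Set.range (X : σ → MvPolynomial σ k))
  range_aug : LinearMap.range aug = I
  exact_aug : Function.Exact (diff 0) aug
  exact_diff : ∀ i, Function.Exact (diff (i + 1)) (diff i)

/-- The graded Betti number `β_{i,j}` read off from a minimal graded free resolution: the number
of summands `R(-j)` of `F_i`. -/
def MinimalGradedFreeResolution.betti {I : Ideal (MvPolynomial σ k)}
    (F : MinimalGradedFreeResolution I) (i j : ℕ) : ℕ :=
  (Finset.univ.filter fun a => F.shift i a = j).card

/-- `I` is generated in degree `d` and has a linear resolution: `β_{i,j}(I) = 0` for all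
`j ≠ i + d`.  (Minimal graded free resolutions are unique up to isomorphism, so the Betti numbers
may be read off from any one of them.) -/
def HasLinearResolution (I : Ideal (MvPolynomial σ k)) (d : ℕ) : Prop :=
  component I d = I ∧
    ∃ F : MinimalGradedFreeResolution I, ∀ i j, j ≠ i + d → F.betti i j = 0

attribute [local instance] MvPolynomial.gradedAlgebra in
/-- A homogeneous ideal `I` is componentwise linear if `(I_d)` has a linear resolution for
all `d`. -/
def IsComponentwiseLinear (I : Ideal (MvPolynomial σ k)) : Prop :=
  I.IsHomogeneous (homogeneousSubmodule σ k) ∧ ∀ d, HasLinearResolution (component I d) d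

/-- `I` is generated by monomials. -/
def IsMonomialIdeal (I : Ideal (MvPolynomial σ k)) : Prop :=
  ∃ S : Set (σ →₀ ℕ), I = Ideal.span ((fun a => monomial a (1 : k)) '' S)

/-- `x^a` is a minimal monomial generator of `I`: it lies in `I`, and no proper divisor of it
does. -/
def IsMinimalGenerator (I : Ideal (MvPolynomial σ k)) (a : σ →₀ ℕ) : Prop :=
  Minimal (fun b => monomial b (1 : k) ∈ I) a

/-- A polymatroidal ideal: a monomial ideal generated in a single degree such that for all minimal
generators `u = x^a` and `v = x^b` and every `i` with `a_i > b_i` there is a `j` with `a_j < b_j`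
and `x_j u / x_i ∈ I`. -/
def IsPolymatroidal (I : Ideal (MvPolynomial σ k)) : Prop :=
  IsMonomialIdeal I ∧
  (∃ d, ∀ a, IsMinimalGenerator I a → a.degree = d) ∧
  ∀ a b, IsMinimalGenerator I a → IsMinimalGenerator I b → ∀ i, b i < a i →
    ∃ j, a j < b j ∧
      monomial (a - Finsupp.single i 1 + Finsupp.single j 1) (1 : k) ∈ I

end Resolutions

section Points

open MvPolynomial

variable {r : ℕ}

/-- The variables `x_{i,j}` (`i` in `Fin r`, `0 ≤ j ≤ n_i`) of the coordinate ring of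
`ℙ^{n_1} × ⋯ × ℙ^{n_r}`. -/
abbrev Var (n : Fin r → ℕ) : Type := (i : Fin r) × Fin (n i + 1)

variable (k : Type*) [Field k]

/-- The projective space `ℙ^m` over `k` (its `k`-rational points). -/
abbrev Proj (m : ℕ) : Type _ := Projectivization k (Fin (m + 1) → k)

/-- The points of `ℙ^{n_1} × ⋯ × ℙ^{n_r}`. -/
abbrev MultiProj (n : Fin r → ℕ) : Type _ := ∀ i, Proj k (n i)

variable {k}

/-- The defining ideal of a point of `ℙ^m`, generated by the forms that vanish there. -/
noncomputable def projPointIdeal {m : ℕ} (p : Proj k m) :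
    Ideal (MvPolynomial (Fin (m + 1)) k) :=
  Ideal.span {f | (∃ d, f.IsHomogeneous d) ∧ eval p.rep f = 0}

/-- The defining ideal of `P = P_1 × ⋯ × P_r`, generated by the generators of the defining ideals
of all the `P_i`, written in the `i`-th block of variables. -/
noncomputable def pointIdeal {n : Fin r → ℕ} (P : MultiProj k n) :
    Ideal (MvPolynomial (Var n) k) :=
  ⨆ i, (projPointIdeal (P i)).map
    (rename (R := k) (fun j => (⟨i, j⟩ : Var n)))

/-- The ideal `I_{P_0}^{a_0} ∩ ⋯ ∩ I_{P_s}^{a_s}` of a scheme of fat points. -/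
noncomputable def fatIdeal {n : Fin r → ℕ} {s : ℕ} (P : Fin (s + 1) → MultiProj k n)
    (a : Fin (s + 1) → ℕ) : Ideal (MvPolynomial (Var n) k) :=
  ⨅ t, pointIdeal (P t) ^ a t

/-- Linear general position: whenever `L = L_1 × ⋯ × L_r` with `L_i = ℙ(W i)` a linear subspace of
`ℙ^{n_i}` of dimension `d_i`, not all of them the whole space, `L` contains at most
`min d_i + 1` points of `X`. -/
def LinearGeneralPosition {n : Fin r → ℕ} (X : Set (MultiProj k n)) : Prop :=
  ∀ (d : Fin r → ℕ) (W : ∀ i, Submodule k (Fin (n i + 1) → k)),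
    (∀ i, Module.finrank k (W i) = d i + 1) → (∃ j, d j < n j) →
    {p | p ∈ X ∧ ∀ i, (p i).submodule ≤ W i}.encard ≤ (((⨅ i, d i) + 1 : ℕ) : ℕ∞)

/-- The linear substitution `x_{i,j} ↦ ∑_l (B_i)_{j,l} x_{i,l}` in each block of variables, that is
`f ↦ f ∘ (B_1 × ⋯ × B_r)`. -/
noncomputable def coordChange {n : Fin r → ℕ}
    (B : ∀ i, Matrix (Fin (n i + 1)) (Fin (n i + 1)) k) :
    MvPolynomial (Var n) k →ₐ[k] MvPolynomial (Var n) k :=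
  aeval fun v => ∑ l, C (B v.1 v.2 l) * X (⟨v.1, l⟩ : Var n)

end Points

end FatPoints

namespace FatPoints

/-! General position makes the components of the `s + 1` points linearly independent in every factor
(`LinearGeneralPosition.linearIndependent`), so they extend to bases and become coordinate vertices.
Each point ideal is then generated by the variables whose second index is not `t`, its powers are
cut out by degree conditions on single monomials (`mem_span_X_pow_iff`), and the intersection is a
monomial ideal: a monomial survives iff its degree outside the `t`-th block is at least `a t` for
every `t`, where a block collects the variables with equal second index over all factors.

In a fixed degree `d` these conditions bound from above the degrees in disjoint blocks. Such
exponent vectors are the bases of a discrete polymatroid; `exists_exchange` proves the exchange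
property directly.

For linearity, the generators are added in lexicographic order. Exchange shows that each successive
colon ideal is generated by variables, so it has a linear resolution, and the sequence `0 → I → I +
(m) → (R/L)(-d) → 0` with the horseshoe lemma carries linearity along. The recursive predicate
`HasLinearSyzygies` does the bookkeeping: generators in the lowest degree, no constant relations
(minimality), and a syzygy module of the same kind. Unfolding it produces the minimal graded free
resolution. -/

theorem append_mem {R S : Type*} [SetLike S R] {𝒜 : ℕ → S} {n m : ℕ} {x : Fin n → R}
    {y : Fin m → R} {e : ℕ} :
    (∀ i, Fin.append x y i ∈ 𝒜 e) ↔ (∀ i, x i ∈ 𝒜 e) ∧ ∀ i, y i ∈ 𝒜 e := by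
  simp [Fin.forall_fin_add]

/-! ### Linear resolutions as a recursive property of graded pieces; the horseshoe lemma -/

section LinearSyzygies

universe u

variable {R : Type u} [CommRing R] {S : Type*} [SetLike S R] [AddSubgroupClass S R]

/-- The forms of degree `e + 1` in the kernel of a map out of a free module. -/
def syzygies (𝒜 : ℕ → S) {n : ℕ} {M : Type u} [AddCommGroup M] [Module R M]
    (φ : (Fin n → R) →ₗ[R] M) (e : ℕ) : AddSubgroup (Fin n → R) where
  carrier := {x | φ x = 0 ∧ ∀ i, x i ∈ 𝒜 (e + 1)}
  add_mem' := fun hx hy => ⟨by simp [hx.1, hy.1], fun i => add_mem (hx.2 i) (hy.2 i)⟩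
  zero_mem' := ⟨map_zero _, fun _ => zero_mem _⟩
  neg_mem' := fun hx => ⟨by simp [hx.1], fun i => neg_mem (hx.2 i)⟩

theorem mem_syzygies {𝒜 : ℕ → S} {n : ℕ} {M : Type u} [AddCommGroup M] [Module R M]
    {φ : (Fin n → R) →ₗ[R] M} {e : ℕ} {x : Fin n → R} :
    x ∈ syzygies 𝒜 φ e ↔ φ x = 0 ∧ ∀ i, x i ∈ 𝒜 (e + 1) := Iff.rfl

theorem range_le_of_single_mem {R M : Type*} [CommRing R] [AddCommGroup M] [Module R M] {n : ℕ}
    {φ : (Fin n → R) →ₗ[R] M} {N : Submodule R M} (h : ∀ i, φ (Pi.single i 1) ∈ N) :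
    LinearMap.range φ ≤ N := by
  rintro _ ⟨x, rfl⟩
  rw [pi_eq_sum_univ' x, map_sum]
  refine sum_mem fun i _ => ?_
  rw [map_smul]
  exact N.smul_mem _ (h i)

/-- The syzygies depend only on the kernel, so one stage of a resolution can be stored as a
submodule, without the map that produced it. -/
theorem syzygies_ker (𝒜 : ℕ → S) {n : ℕ} {M : Type u} [AddCommGroup M] [Module R M]
    (φ : (Fin n → R) →ₗ[R] M) :
    syzygies 𝒜 (LinearMap.ker φ).mkQ = syzygies 𝒜 φ := by
  ext e x
  simp [mem_syzygies]

/-- The graded pieces `G 0, G 1, …` form a graded module that is generated by `G 0` and has a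
linear free resolution with at most `h` terms. -/
def HasLinearSyzygies (𝒜 : ℕ → S) :
    ℕ → ∀ (M : Type u) [AddCommGroup M] [Module R M], (ℕ → AddSubgroup M) → Prop
  | 0, _, _, _, G => ∀ e, G e = ⊥
  | h + 1, M, _, _, G => ∃ (n : ℕ) (φ : (Fin n → R) →ₗ[R] M),
      (∀ i, φ (Pi.single i 1) ∈ G 0) ∧
      (∀ e, ∀ m ∈ G e, ∃ x : Fin n → R, (∀ i, x i ∈ 𝒜 e) ∧ φ x = m) ∧
      (∀ x : Fin n → R, (∀ i, x i ∈ 𝒜 0) → φ x = 0 → x = 0) ∧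
      HasLinearSyzygies 𝒜 h (Fin n → R) (syzygies 𝒜 φ)

namespace HasLinearSyzygies

variable {𝒜 : ℕ → S}

theorem of_eq_bot (h : ℕ) : ∀ {M : Type u} [AddCommGroup M] [Module R M]
    {G : ℕ → AddSubgroup M}, (∀ e, G e = ⊥) → HasLinearSyzygies 𝒜 h M G := by
  induction h with
  | zero => intro M _ _ G hG; exact hG
  | succ h ih =>
    intro M _ _ G hG
    refine ⟨0, 0, fun i => i.elim0, fun e m hm => ⟨0, fun i => i.elim0, ?_⟩,
      fun x _ _ => Subsingleton.elim _ _, ih fun e => Subsingleton.elim _ _⟩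
    rw [hG e, AddSubgroup.mem_bot] at hm
    simp [hm]

theorem mono {h h' : ℕ} (hh : h ≤ h') : ∀ {M : Type u} [AddCommGroup M] [Module R M]
    {G : ℕ → AddSubgroup M}, HasLinearSyzygies 𝒜 h M G → HasLinearSyzygies 𝒜 h' M G := by
  induction h generalizing h' with
  | zero => intro M _ _ G hG; exact of_eq_bot h' hG
  | succ h ih =>
    intro M _ _ G hG
    obtain ⟨h', rfl⟩ : ∃ l, h' = l + 1 := ⟨h' - 1, by omega⟩
    obtain ⟨n, φ, h1, h2, h3, h4⟩ := hG
    exact ⟨n, φ, h1, h2, h3, ih (by omega) h4⟩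

theorem congr {h : ℕ} {M N : Type u} [AddCommGroup M] [Module R M] [AddCommGroup N] [Module R N]
    {G : ℕ → AddSubgroup M} {G' : ℕ → AddSubgroup N} (ε : M ≃ₗ[R] N)
    (hε : ∀ e m, m ∈ G e ↔ ε m ∈ G' e) (hG : HasLinearSyzygies 𝒜 h M G) :
    HasLinearSyzygies 𝒜 h N G' := by
  cases h with
  | zero =>
    intro e
    refine (AddSubgroup.eq_bot_iff_forall _).2 fun y hy => ?_
    have : ε.symm y ∈ G e := (hε e _).2 (by simpa using hy)
    rw [hG e, AddSubgroup.mem_bot] at this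
    simpa using this
  | succ h =>
    obtain ⟨n, φ, h1, h2, h3, h4⟩ := hG
    refine ⟨n, ε.toLinearMap ∘ₗ φ, fun i => (hε _ _).1 (h1 i), fun e y hy => ?_, ?_, ?_⟩
    · obtain ⟨x, hx, hx'⟩ := h2 e (ε.symm y) ((hε e _).2 (by simpa using hy))
      exact ⟨x, hx, by simp [hx']⟩
    · intro x hx hx'
      exact h3 x hx (by simpa using hx')
    · convert h4 using 2 with e
      ext x
      simp [mem_syzygies]

/-- The inclusion of the first `n` coordinates. -/
def appendZero (R : Type u) [CommRing R] (n m : ℕ) : (Fin n → R) →ₗ[R] (Fin (n + m) → R) where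
  toFun x := Fin.append x 0
  map_add' x y := by
    ext i; refine Fin.addCases (fun i => ?_) (fun i => ?_) i <;> simp
  map_smul' c x := by
    ext i; refine Fin.addCases (fun i => ?_) (fun i => ?_) i <;> simp

theorem appendZero_apply {n m : ℕ} (x : Fin n → R) : appendZero R n m x = Fin.append x 0 := rfl

/-- The horseshoe lemma for linear resolutions. -/
theorem horseshoe [SetLike.GradedMonoid 𝒜] (h : ℕ) : ∀ {A B C : Type u}
    [AddCommGroup A] [Module R A] [AddCommGroup B] [Module R B] [AddCommGroup C] [Module R C]
    {GA : ℕ → AddSubgroup A} {GB : ℕ → AddSubgroup B} {GC : ℕ → AddSubgroup C}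
    (ι : A →ₗ[R] B) (π : B →ₗ[R] C),
    (∀ e f r b, r ∈ 𝒜 e → b ∈ GB f → r • b ∈ GB (e + f)) → Function.Injective ι →
    (∀ e, ∀ a ∈ GA e, ι a ∈ GB e) → (∀ e, ∀ a ∈ GA e, π (ι a) = 0) →
    (∀ e, ∀ b ∈ GB e, π b ∈ GC e) → (∀ e, ∀ c ∈ GC e, ∃ b ∈ GB e, π b = c) →
    (∀ e, ∀ b ∈ GB e, π b = 0 → ∃ a ∈ GA e, ι a = b) →
    HasLinearSyzygies 𝒜 h A GA → HasLinearSyzygies 𝒜 h C GC → HasLinearSyzygies 𝒜 h B GB := by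
  induction h with
  | zero =>
    intro A B C _ _ _ _ _ _ GA GB GC ι π _ _ _ _ hπ _ hex hA hC e
    refine (AddSubgroup.eq_bot_iff_forall _).2 fun b hb => ?_
    have h1 := hπ e b hb
    rw [hC e, AddSubgroup.mem_bot] at h1
    obtain ⟨a, ha, rfl⟩ := hex e b hb h1
    rw [hA e, AddSubgroup.mem_bot] at ha
    simp [ha]
  | succ h ih =>
    intro A B C _ _ _ _ _ _ GA GB GC ι π hsm hinj hι hcomp hπ hsurj hex hA hC
    obtain ⟨n, α, a1, a2, a3, a4⟩ := hA
    obtain ⟨m, γ, c1, c2, c3, c4⟩ := hC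
    -- Lift the generators of `C` to degree-zero elements of `B`; together with those of `A` they
    -- generate `B`.
    choose b hb hb' using fun i => hsurj 0 _ (c1 i)
    let ψ : (Fin m → R) →ₗ[R] B := Fintype.linearCombination R b
    have hπψ : ∀ x, π (ψ x) = γ x := by
      intro x
      have : π ∘ₗ ψ = γ := LinearMap.pi_ext' fun i => LinearMap.ext_ring (by
        simp [ψ, Fintype.linearCombination_apply_single, hb'])
      exact LinearMap.congr_fun this x
    -- `π ∘ ι` is only assumed to vanish on the graded pieces of `A`, so vanishing is checked on the
    -- generators and extended linearly.
    have hπα : ∀ x, π (ι (α x)) = 0 := by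
      intro x
      have : π ∘ₗ ι ∘ₗ α = 0 :=
        LinearMap.pi_ext' fun i => LinearMap.ext_ring (by simp [hcomp 0 _ (a1 i)])
      exact LinearMap.congr_fun this x
    have hψG : ∀ e x, (∀ i, x i ∈ 𝒜 e) → ψ x ∈ GB e := by
      intro e x hx
      rw [Fintype.linearCombination_apply]
      exact sum_mem fun i _ => hsm e 0 (x i) (b i) (hx i) (hb i)
    let β : (Fin (n + m) → R) →ₗ[R] B :=
      ι ∘ₗ α ∘ₗ LinearMap.funLeft R R (Fin.castAdd m) + ψ ∘ₗ LinearMap.funLeft R R (Fin.natAdd n)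
    have hβ : ∀ x y, β (Fin.append x y) = ι (α x) + ψ y := by
      intro x y
      have h1 : (Fin.append x y ∘ Fin.castAdd m) = x := by ext; simp
      have h2 : (Fin.append x y ∘ Fin.natAdd n) = y := by ext; simp
      simp [β, LinearMap.funLeft, h1, h2]
    have happ : ∀ x : Fin (n + m) → R, ∃ y z, x = Fin.append y z :=
      fun x => ⟨_, _, (Fin.append_castAdd_natAdd (f := x)).symm⟩
    have hπβ : ∀ y z, β (Fin.append y z) = 0 → γ z = 0 := by
      intro y z hx
      have := congrArg π hx
      rwa [hβ, map_add, hπα, hπψ, zero_add, map_zero] at this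
    refine ⟨n + m, β, ?_, ?_, ?_, ?_⟩
    · intro i
      have key : ∀ x y, (Fin.append x y : Fin (n + m) → R) = Pi.single i 1 →
        β (Pi.single i 1) = ι (α x) + ψ y := fun x y h => by rw [← h, hβ]
      refine Fin.addCases (fun i key => ?_) (fun i key => ?_) i key
      · rw [key (Pi.single i 1) 0]
        · simpa using hι _ _ (a1 i)
        · ext j
          refine Fin.addCases (fun j => ?_) (fun j => ?_) j
          · simp [Pi.single_apply]
          · simp [Pi.single_apply, Fin.ext_iff]; omega
      · rw [key 0 (Pi.single i 1)]
        · simpa [ψ, Fintype.linearCombination_apply_single] using hb i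
        · ext j
          refine Fin.addCases (fun j => ?_) (fun j => ?_) j
          · simp [Pi.single_apply, Fin.ext_iff]; omega
          · simp [Pi.single_apply]
    · intro e x hx
      obtain ⟨g, hg, hg'⟩ := c2 e _ (hπ e x hx)
      obtain ⟨a, ha, ha'⟩ := hex e (x - ψ g) (sub_mem hx (hψG e g hg)) (by
        rw [map_sub, hπψ, hg', sub_self])
      obtain ⟨f, hf, rfl⟩ := a2 e a ha
      exact ⟨Fin.append f g, append_mem.2 ⟨hf, hg⟩, by rw [hβ, ha', sub_add_cancel]⟩
    · intro x hx h0
      obtain ⟨y, z, rfl⟩ := happ x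
      obtain ⟨hy, hz⟩ := append_mem.1 hx
      have hz0 := c3 z hz (hπβ y z h0)
      subst hz0
      rw [hβ, map_zero, add_zero, map_eq_zero_iff _ hinj] at h0
      rw [a3 y hy h0]
      ext i; refine Fin.addCases (fun i => ?_) (fun i => ?_) i <;> simp
    · refine ih (appendZero R n m) (LinearMap.funLeft R R (Fin.natAdd n)) ?_ ?_ ?_ ?_ ?_ ?_ ?_ a4 c4
      · rintro e f r x hr ⟨hx, hx'⟩
        refine ⟨by simp [hx], fun i => ?_⟩
        simpa [add_assoc] using SetLike.mul_mem_graded hr (hx' i)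
      · intro x y hxy
        ext i
        simpa [appendZero_apply] using congrFun hxy (Fin.castAdd m i)
      · rintro e x ⟨hx, hx'⟩
        rw [mem_syzygies, appendZero_apply, hβ, hx, append_mem]
        simp [hx', zero_mem]
      · intro e x _
        ext i
        simp [appendZero_apply, LinearMap.funLeft]
      · rintro e x ⟨hx, hx'⟩
        obtain ⟨y, z, rfl⟩ := happ x
        have h2 : (Fin.append y z ∘ Fin.natAdd n) = z := by ext; simp
        simp only [mem_syzygies, LinearMap.funLeft, LinearMap.coe_mk, AddHom.coe_mk, h2]
        exact ⟨hπβ _ _ hx, (append_mem.1 hx').2⟩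
      · rintro e z ⟨hz, hz'⟩
        -- A syzygy `z` of `C` lifts: `ψ z` dies in `C`, hence comes from some `α f`, and `(-f, z)`
        -- is a syzygy of `B`. The degree is `e + 1` because syzygies are indexed from degree one.
        obtain ⟨a, ha, ha'⟩ := hex (e + 1) (ψ z) (hψG _ _ hz') (by rw [hπψ, hz])
        obtain ⟨f, hf, rfl⟩ := a2 _ a ha
        refine ⟨Fin.append (-f) z, ⟨?_, append_mem.2 ⟨fun i => neg_mem (hf i), hz'⟩⟩, ?_⟩
        · rw [hβ, map_neg, map_neg, ha', neg_add_cancel]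
        · ext i; simp [LinearMap.funLeft]
      · rintro e x ⟨hx, hx'⟩ h0
        obtain ⟨y, z, rfl⟩ := happ x
        have h2 : (Fin.append y z ∘ Fin.natAdd n) = z := by ext; simp
        simp only [LinearMap.funLeft, LinearMap.coe_mk, AddHom.coe_mk, h2] at h0
        subst h0
        rw [hβ, map_zero, add_zero, map_eq_zero_iff _ hinj] at hx
        exact ⟨y, ⟨hx, (append_mem.1 hx').1⟩, rfl⟩

end HasLinearSyzygies
end LinearSyzygies

/-! ### Graded ideals: adding one generator, and assembling the resolution -/

section GradedIdeals

open MvPolynomial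

variable {σ k : Type*} [Field k]

theorem homogeneousComponent_mul_of_isHomogeneous {m : MvPolynomial σ k} {d : ℕ}
    (hm : m.IsHomogeneous d) (r : MvPolynomial σ k) (e : ℕ) :
    homogeneousComponent (e + d) (r * m) = homogeneousComponent e r * m := by
  classical
  conv_lhs => rw [← sum_homogeneousComponent r, Finset.sum_mul, map_sum]
  rw [Finset.sum_congr rfl fun i _ => homogeneousComponent_of_mem (n := i + d)
    ((homogeneousComponent_isHomogeneous i r).mul hm)]
  simp only [add_left_inj]
  rw [Finset.sum_ite_eq]
  split_ifs with h
  · rfl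
  · rw [homogeneousComponent_eq_zero, zero_mul]
    simpa using h

/-- The forms of degree `d + e` in an ideal. -/
noncomputable def forms (I : Ideal (MvPolynomial σ k)) (d e : ℕ) : AddSubgroup (MvPolynomial σ k) :=
  I.toAddSubgroup ⊓ (homogeneousSubmodule σ k (d + e)).toAddSubgroup

theorem mem_forms {I : Ideal (MvPolynomial σ k)} {d e : ℕ} {f : MvPolynomial σ k} :
    f ∈ forms I d e ↔ f ∈ I ∧ f.IsHomogeneous (d + e) := Iff.rfl

/-- Adding a form `m` of degree `d` to an ideal generated in degree `d` preserves linearity of the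
resolution if the colon ideal by `m` has a `1`-linear resolution. -/
theorem HasLinearSyzygies.sup_span {I L : Ideal (MvPolynomial σ k)} {d h : ℕ}
    {m : MvPolynomial σ k} (hI : ∀ f ∈ I, ∀ n, homogeneousComponent n f ∈ I)
    (hm : m.IsHomogeneous d) (hmI : m ∉ I) (hL : ∀ r, r * m ∈ I ↔ r ∈ L)
    (h1 : HasLinearSyzygies (homogeneousSubmodule σ k) h (MvPolynomial σ k) (forms I d))
    (h2 : HasLinearSyzygies (homogeneousSubmodule σ k) h (MvPolynomial σ k) (forms L 1)) :
    HasLinearSyzygies (homogeneousSubmodule σ k) (h + 1) (MvPolynomial σ k)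
      (forms (I ⊔ Ideal.span {m}) d) := by
  have : SetLike.GradedMonoid (homogeneousSubmodule σ k) := HomogeneousSubmodule.gradedMonoid
  let π : MvPolynomial σ k →ₗ[MvPolynomial σ k] (MvPolynomial σ k ⧸ I) := Submodule.mkQ I
  have hπ : ∀ f, π f = 0 ↔ f ∈ I := fun f => by
    rw [Submodule.mkQ_apply, Submodule.Quotient.mk_eq_zero]
  let γ : (Fin 1 → MvPolynomial σ k) →ₗ[MvPolynomial σ k] (MvPolynomial σ k ⧸ I) :=
    π ∘ₗ LinearMap.toSpanSingleton _ _ m ∘ₗ LinearMap.proj 0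
  have hγ : ∀ x, γ x = π (x 0 * m) := fun x => rfl
  have hmem : ∀ r, r * m ∈ I ⊔ Ideal.span {m} := fun r =>
    Ideal.mul_mem_left _ _ (Ideal.mem_sup_right (Ideal.mem_span_singleton_self m))
  -- The quotient `(I + (m))/I` is cyclic on the class of `m`, with syzygy module the colon ideal
  -- `L`.
  have hC : HasLinearSyzygies (homogeneousSubmodule σ k) (h + 1) (MvPolynomial σ k ⧸ I)
      (fun e => (forms (I ⊔ Ideal.span {m}) d e).map π.toAddMonoidHom) := by
    refine ⟨1, γ, ?_, ?_, ?_, ?_⟩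
    · intro i
      refine ⟨m, ⟨by simpa using hmem 1, hm⟩, ?_⟩
      rw [hγ, Subsingleton.elim i 0, Pi.single_eq_same, one_mul]
      rfl
    · rintro e _ ⟨b, ⟨hb, hb'⟩, rfl⟩
      obtain ⟨i, hi, y, hy, rfl⟩ := Submodule.mem_sup.1 hb
      obtain ⟨r, rfl⟩ := Ideal.mem_span_singleton'.1 hy
      refine ⟨fun _ => homogeneousComponent e r, fun _ => homogeneousComponent_isHomogeneous e r, ?_⟩
      have h3 := homogeneousComponent_of_mem (m := d + e) hb'
      rw [if_pos rfl, map_add, add_comm d e, homogeneousComponent_mul_of_isHomogeneous hm] at h3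
      rw [hγ]
      change _ = π _
      rw [← h3, map_add, (hπ _).2 (hI i hi _), zero_add]
    · intro x hx h0
      have hx0 := (totalDegree_zero_iff_isHomogeneous σ).2 (hx 0)
      rw [totalDegree_eq_zero_iff_eq_C] at hx0
      rw [hγ, hπ, hx0] at h0
      ext1 i
      rw [Subsingleton.elim i 0, hx0]
      -- A nonzero constant relation would be invertible and put `m` into `I`.
      by_contra hne
      have hc : coeff 0 (x 0) ≠ 0 := fun h => hne (by simp [h])
      apply hmI
      have := I.mul_mem_left (C (coeff 0 (x 0))⁻¹) h0
      rwa [← mul_assoc, ← C_mul, inv_mul_cancel₀ hc, C_1, one_mul] at this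
    · refine h2.congr (LinearEquiv.funUnique (Fin 1) _ _).symm fun e r => ?_
      rw [mem_forms, mem_syzygies, hγ, hπ]
      simp [hL, add_comm]
  -- Both ideals live in the ambient module `R`; only the families of graded pieces distinguish
  -- them, so the inclusion is the identity.
  refine horseshoe (h + 1) (LinearMap.id) π ?_ Function.injective_id ?_ ?_ ?_ ?_ ?_
    (h1.mono (Nat.le_succ h)) hC
  · rintro e f r b hr ⟨hb, hb'⟩
    refine ⟨Submodule.smul_mem (I ⊔ Ideal.span {m}) r hb, ?_⟩
    have := IsHomogeneous.mul hr hb'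
    rwa [← add_assoc, add_comm e d, add_assoc] at this
  · rintro e a ⟨ha, ha'⟩
    exact ⟨Ideal.mem_sup_left ha, ha'⟩
  · rintro e a ⟨ha, ha'⟩
    exact (hπ _).2 ha
  · exact fun e b hb => ⟨b, hb, rfl⟩
  · rintro e _ ⟨b, hb, rfl⟩
    exact ⟨b, hb, rfl⟩
  · rintro e b ⟨hb, hb'⟩ h0
    exact ⟨b, ⟨(hπ _).1 h0, hb'⟩, rfl⟩

theorem homogeneousComponent_map {n δ : ℕ}
    (ψ : (Fin n → MvPolynomial σ k) →ₗ[MvPolynomial σ k] MvPolynomial σ k)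
    (hψ : ∀ i, (ψ (Pi.single i 1)).IsHomogeneous δ) (x : Fin n → MvPolynomial σ k) (e : ℕ) :
    ψ (fun i => homogeneousComponent e (x i)) = homogeneousComponent (e + δ) (ψ x) := by
  have key : ∀ y : Fin n → MvPolynomial σ k, ψ y = ∑ i, y i * ψ (Pi.single i 1) := by
    intro y
    conv_lhs => rw [pi_eq_sum_univ' y, map_sum]
    simp
  rw [key, key x, map_sum]
  exact Finset.sum_congr rfl fun i _ => (homogeneousComponent_mul_of_isHomogeneous (hψ i) _ _).symm

variable (σ k) in
/-- A graded submodule of a free module without constants, with a linear resolution. -/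
structure LinearSyzygyModule where
  /-- the rank of the ambient free module -/
  n : ℕ
  /-- the submodule -/
  K : Submodule (MvPolynomial σ k) (Fin n → MvPolynomial σ k)
  /-- a bound for the length of the resolution -/
  h : ℕ
  component_mem : ∀ x ∈ K, ∀ e, (fun i => homogeneousComponent e (x i)) ∈ K
  eq_zero : ∀ x ∈ K, (∀ i, (x i).IsHomogeneous 0) → x = 0
  linear : HasLinearSyzygies (homogeneousSubmodule σ k) h (Fin n → MvPolynomial σ k)
    (syzygies (homogeneousSubmodule σ k) K.mkQ)

/-- The module of syzygies of a homogeneous map. -/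
noncomputable def LinearSyzygyModule.ofKer {n δ h : ℕ} {ι : Type*}
    (φ : (Fin n → MvPolynomial σ k) →ₗ[MvPolynomial σ k] (ι → MvPolynomial σ k))
    (h1 : ∀ i a, (φ (Pi.single i 1) a).IsHomogeneous δ)
    (h2 : ∀ x : Fin n → MvPolynomial σ k, (∀ i, (x i).IsHomogeneous 0) → φ x = 0 → x = 0)
    (h3 : HasLinearSyzygies (homogeneousSubmodule σ k) h (Fin n → MvPolynomial σ k)
      (syzygies (homogeneousSubmodule σ k) (LinearMap.ker φ).mkQ)) :
    LinearSyzygyModule σ k where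
  n := n
  K := LinearMap.ker φ
  h := h
  component_mem x hx e := by
    rw [LinearMap.mem_ker] at hx ⊢
    ext1 a
    have := homogeneousComponent_map (LinearMap.proj a ∘ₗ φ) (fun i => h1 i a) x e
    simpa [hx] using this
  eq_zero x hx hx' := h2 x hx' hx
  linear := h3

namespace LinearSyzygyModule

variable (s : LinearSyzygyModule σ k)

/-- `K` contains the homogeneous components of its elements, and their constant components vanish,
so only components of positive degree need checking. -/
theorem le_of_forms_le {N : Submodule (MvPolynomial σ k) (Fin s.n → MvPolynomial σ k)}
    (hN : ∀ e, ∀ x ∈ s.K, (∀ i, (x i).IsHomogeneous (e + 1)) → x ∈ N) : s.K ≤ N := by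
  intro x hx
  obtain ⟨D, hD⟩ : ∃ D, ∀ i, (x i).totalDegree < D :=
    ⟨Finset.univ.sup (fun i => (x i).totalDegree) + 1, fun i =>
      Nat.lt_succ_of_le (Finset.le_sup (f := fun i => (x i).totalDegree) (Finset.mem_univ i))⟩
  have hsum : x = ∑ e ∈ Finset.range D, fun i => homogeneousComponent e (x i) := by
    ext1 i
    rw [Finset.sum_apply]
    conv_lhs => rw [← sum_homogeneousComponent (x i)]
    refine Finset.sum_subset (Finset.range_mono (hD i)) fun e _ he => ?_
    exact homogeneousComponent_eq_zero _ _ (by simpa using he)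
  rw [hsum]
  refine sum_mem fun e _ => ?_
  have hc := s.component_mem x hx e
  cases e with
  | zero =>
    rw [s.eq_zero _ hc fun i => homogeneousComponent_isHomogeneous 0 _]
    exact zero_mem _
  | succ e => exact hN e _ hc fun i => homogeneousComponent_isHomogeneous _ _

/-- One step of the resolution. If the length bound is already `0`, then `K = 0` and the free module
of rank zero continues the sequence; this makes the iteration total and eventually zero. -/
theorem exists_cover : ∃ (t : LinearSyzygyModule σ k)
    (φ : (Fin t.n → MvPolynomial σ k) →ₗ[MvPolynomial σ k] (Fin s.n → MvPolynomial σ k)),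
    (∀ i a, (φ (Pi.single i 1) a).IsHomogeneous 1) ∧ LinearMap.range φ = s.K ∧
    LinearMap.ker φ = t.K ∧ t.h = s.h - 1 ∧ (s.h = 0 → t.n = 0) := by
  rcases hs : s.h with _ | h
  · have hlin := s.linear
    rw [hs] at hlin
    have hK : s.K = ⊥ := le_bot_iff.1 (s.le_of_forms_le fun e x hx hx' => by
      have : x ∈ syzygies (homogeneousSubmodule σ k) s.K.mkQ e := ⟨by simpa using hx, hx'⟩
      rw [hlin e] at this
      exact this)
    refine ⟨⟨0, ⊤, 0, fun _ _ _ => trivial, fun _ _ _ => Subsingleton.elim _ _,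
      fun _ => Subsingleton.elim _ _⟩, 0, fun i => i.elim0, ?_, ?_, rfl, fun _ => rfl⟩
    · rw [LinearMap.range_zero, hK]
    · exact LinearMap.ker_zero
  · have hlin := s.linear
    rw [hs] at hlin
    obtain ⟨m, φ, h1, h2, h3, h4⟩ := hlin
    have hmem : ∀ i, φ (Pi.single i 1) ∈ s.K := fun i => by simpa using (h1 i).1
    refine ⟨ofKer φ (δ := 1) (h := h) (fun i a => (h1 i).2 a) h3 (by rw [syzygies_ker]; exact h4),
      φ, fun i a => (h1 i).2 a, ?_, rfl, rfl, fun h => by omega⟩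
    apply le_antisymm
    · exact range_le_of_single_mem hmem
    · refine s.le_of_forms_le fun e x hx hx' => ?_
      obtain ⟨y, _, hy⟩ := h2 e x ⟨by simpa using hx, hx'⟩
      exact ⟨y, hy⟩

/-- The next module of syzygies. -/
noncomputable def next : LinearSyzygyModule σ k := s.exists_cover.choose

/-- The linear presentation of a module of syzygies. -/
noncomputable def cover :
    (Fin s.next.n → MvPolynomial σ k) →ₗ[MvPolynomial σ k] (Fin s.n → MvPolynomial σ k) :=
  s.exists_cover.choose_spec.choose

theorem cover_spec : (∀ i a, (s.cover (Pi.single i 1) a).IsHomogeneous 1) ∧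
    LinearMap.range s.cover = s.K ∧ LinearMap.ker s.cover = s.next.K ∧ s.next.h = s.h - 1 ∧
    (s.h = 0 → s.next.n = 0) :=
  s.exists_cover.choose_spec.choose_spec

theorem exact_cover : Function.Exact s.next.cover s.cover :=
  LinearMap.exact_iff.2 (s.cover_spec.2.2.1.trans s.next.cover_spec.2.1.symm)

/-- The sequence of iterated modules of syzygies. -/
noncomputable def iter : ℕ → LinearSyzygyModule σ k
  | 0 => s
  | i + 1 => (iter i).next

theorem iter_h (i : ℕ) : (s.iter i).h = s.h - i := by
  induction i with
  | zero => rfl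
  | succ i ih =>
    have : (s.iter (i + 1)).h = (s.iter i).h - 1 := (s.iter i).cover_spec.2.2.2.1
    omega

end LinearSyzygyModule

theorem mem_span_range_X_of_isHomogeneous_one {f : MvPolynomial σ k} (hf : f.IsHomogeneous 1) :
    f ∈ Ideal.span (Set.range (X : σ → MvPolynomial σ k)) := by
  rw [← Set.image_univ, mem_ideal_span_X_image]
  intro m hm
  have hd : m.degree = 1 := by
    by_contra hne
    exact mem_support_iff.1 hm (hf.coeff_eq_zero hne)
  by_contra! hz
  have : m = 0 := Finsupp.ext fun i => hz i (Set.mem_univ i)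
  simp [this] at hd

/-- An ideal generated in degree `d` with linear syzygies has a linear resolution. -/
theorem hasLinearResolution_of_hasLinearSyzygies {I : Ideal (MvPolynomial σ k)} {d h : ℕ}
    (hI : component I d = I)
    (hlin : HasLinearSyzygies (homogeneousSubmodule σ k) (h + 1) (MvPolynomial σ k) (forms I d)) :
    HasLinearResolution I d := by
  refine ⟨hI, ?_⟩
  obtain ⟨n, φ, h1, h2, h3, h4⟩ := hlin
  -- `ofKer` expects a target of coordinate vectors, so `R` is replaced by `R` to the power `Fin 1`.
  have hker : LinearMap.ker (LinearMap.pi fun _ : Fin 1 => φ) = LinearMap.ker φ := by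
    ext x; simp [funext_iff]
  let s : LinearSyzygyModule σ k := LinearSyzygyModule.ofKer (δ := d)
    (LinearMap.pi fun _ : Fin 1 => φ) (fun i _ => (h1 i).2)
    (fun x hx hx' => h3 x hx (congrFun hx' 0)) (by rw [hker, syzygies_ker]; exact h4)
  have hsK : s.K = LinearMap.ker φ := hker
  have hexact : Function.Exact s.cover φ :=
    LinearMap.exact_iff.2 (hsK.symm.trans s.cover_spec.2.1.symm)
  let F : MinimalGradedFreeResolution I :=
    { rank := fun i => (s.iter i).n
      shift := fun i _ => i + d
      finite_length := by
        refine ⟨s.h, fun i hi => ?_⟩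
        obtain ⟨i, rfl⟩ : ∃ j, i = j + 1 := ⟨i - 1, by omega⟩
        refine (s.iter i).cover_spec.2.2.2.2 ?_
        rw [s.iter_h]; omega
      aug := φ
      diff := fun i => (s.iter i).cover
      aug_homogeneous := fun a => by rw [zero_add]; exact (h1 a).2
      diff_homogeneous := fun i a b =>
        Or.inr ⟨1, by omega, (s.iter i).cover_spec.1 b a⟩
      minimal := fun i a b =>
        mem_span_range_X_of_isHomogeneous_one ((s.iter i).cover_spec.1 b a)
      range_aug := by
        apply le_antisymm
        · exact range_le_of_single_mem (φ := φ) fun i => (h1 i).1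
        · rw [← hI]
          refine Submodule.span_le.2 ?_
          rintro f ⟨hf, hf'⟩
          obtain ⟨x, _, hx⟩ := h2 0 f ⟨hf, hf'⟩
          exact ⟨x, hx⟩
      exact_aug := hexact
      exact_diff := fun i => (s.iter i).exact_cover }
  refine ⟨F, fun i j hij => ?_⟩
  rw [MinimalGradedFreeResolution.betti, Finset.card_eq_zero, Finset.filter_eq_empty_iff]
  exact fun a _ h => hij h.symm

end GradedIdeals

/-! ### Monomial ideals in changed coordinates and linear quotients -/

section MonomialIdeals

open MvPolynomial

variable {σ k : Type*} [Field k]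

theorem mul_monomial_mem_span_iff {s : Set (σ →₀ ℕ)} {v : σ →₀ ℕ} {f : MvPolynomial σ k} :
    f * monomial v 1 ∈ Ideal.span ((fun a => monomial a (1 : k)) '' s) ↔
      ∀ w ∈ f.support, ∃ u ∈ s, u ≤ w + v := by
  rw [mem_ideal_span_monomial_image]
  constructor
  · intro h w hw
    refine h (w + v) ?_
    rw [mem_support_iff, coeff_mul_monomial, mul_one]
    exact mem_support_iff.1 hw
  · intro h w hw
    rw [mem_support_iff, coeff_mul_monomial'] at hw
    split_ifs at hw with hv
    · obtain ⟨u, hu, huw⟩ := h (w - v) (mem_support_iff.2 (by simpa using hw))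
      exact ⟨u, hu, by rwa [tsub_add_cancel_of_le hv] at huw⟩
    · exact absurd rfl hw

theorem homogeneousComponent_mem_span_monomial {s : Set (σ →₀ ℕ)} {f : MvPolynomial σ k}
    (hf : f ∈ Ideal.span ((fun a => monomial a (1 : k)) '' s)) (n : ℕ) :
    homogeneousComponent n f ∈ Ideal.span ((fun a => monomial a (1 : k)) '' s) := by
  classical
  rw [mem_ideal_span_monomial_image] at hf ⊢
  intro w hw
  rw [support_homogeneousComponent, Finset.mem_filter] at hw
  exact hf w hw.1

theorem homogeneousComponent_algEquiv {τ : Type*} {ψ : MvPolynomial σ k ≃ₐ[k] MvPolynomial τ k}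
    (hψ : ∀ f n, f.IsHomogeneous n → (ψ f).IsHomogeneous n) (f : MvPolynomial σ k) (n : ℕ) :
    homogeneousComponent n (ψ f) = ψ (homogeneousComponent n f) := by
  classical
  conv_lhs => rw [← sum_homogeneousComponent f, map_sum, map_sum]
  rw [Finset.sum_congr rfl fun i _ => homogeneousComponent_of_mem
    (hψ _ _ (homogeneousComponent_isHomogeneous i f)), Finset.sum_ite_eq]
  split_ifs with h
  · rfl
  · rw [homogeneousComponent_eq_zero, map_zero]
    simpa using h

/-- The ideal generated by the monomials with exponents in `s`, in the coordinates given by `ψ`. -/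
noncomputable def monomialIdealIn (ψ : MvPolynomial σ k ≃ₐ[k] MvPolynomial σ k)
    (s : Set (σ →₀ ℕ)) : Ideal (MvPolynomial σ k) :=
  Ideal.span ((fun a => ψ.symm (monomial a (1 : k))) '' s)

variable {ψ : MvPolynomial σ k ≃ₐ[k] MvPolynomial σ k}

/-- Carrying `ψ` along lets monomial arguments resolve the ideal in its original coordinates, so no
resolution has to be transported. -/
theorem mem_monomialIdealIn {s : Set (σ →₀ ℕ)} {f : MvPolynomial σ k} :
    f ∈ monomialIdealIn ψ s ↔ ψ f ∈ Ideal.span ((fun a => monomial a (1 : k)) '' s) := by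
  have : monomialIdealIn ψ s =
      (Ideal.span ((fun a => monomial a (1 : k)) '' s)).map (ψ.symm : _ →+* _) := by
    rw [Ideal.map_span, Set.image_image]
    rfl
  rw [this]
  constructor
  · intro h
    have := Ideal.mem_map_of_mem (ψ : MvPolynomial σ k →+* MvPolynomial σ k) h
    rw [Ideal.map_map] at this
    have hid : (ψ : MvPolynomial σ k →+* MvPolynomial σ k).comp (ψ.symm : _ →+* _) =
        RingHom.id _ := RingHom.ext fun g => ψ.apply_symm_apply g
    rw [hid, Ideal.map_id] at this
    exact this
  · intro h
    simpa using Ideal.mem_map_of_mem (ψ.symm : MvPolynomial σ k →+* MvPolynomial σ k) h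

/-- The combinatorial form of `HasLinearSyzygies.sup_span`: `hcolon` says on exponents that the
colon ideal by the new monomial is generated by `s'`. -/
theorem HasLinearSyzygies.insert_monomial
    (hψ : ∀ f n, f.IsHomogeneous n → (ψ f).IsHomogeneous n)
    (hψ' : ∀ f n, f.IsHomogeneous n → (ψ.symm f).IsHomogeneous n)
    {s s' : Set (σ →₀ ℕ)} {v : σ →₀ ℕ} {d h : ℕ}
    (hv : v.degree = d) (hvs : ∀ u ∈ s, ¬ u ≤ v)
    (hcolon : ∀ w, (∃ u ∈ s, u ≤ w + v) ↔ ∃ u ∈ s', u ≤ w)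
    (h1 : HasLinearSyzygies (homogeneousSubmodule σ k) h (MvPolynomial σ k)
      (forms (monomialIdealIn ψ s) d))
    (h2 : HasLinearSyzygies (homogeneousSubmodule σ k) h (MvPolynomial σ k)
      (forms (monomialIdealIn ψ s') 1)) :
    HasLinearSyzygies (homogeneousSubmodule σ k) (h + 1) (MvPolynomial σ k)
      (forms (monomialIdealIn ψ (insert v s)) d) := by
  have hins : monomialIdealIn ψ (insert v s) =
      monomialIdealIn ψ s ⊔ Ideal.span {ψ.symm (monomial v (1 : k))} := by
    rw [monomialIdealIn, Set.image_insert_eq, Ideal.span_insert, sup_comm, monomialIdealIn]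
  rw [hins]
  refine HasLinearSyzygies.sup_span ?_ (hψ' _ _ (isHomogeneous_monomial _ hv)) ?_ ?_ h1 h2
  · intro f hf n
    rw [mem_monomialIdealIn] at hf ⊢
    rw [← homogeneousComponent_algEquiv hψ]
    exact homogeneousComponent_mem_span_monomial hf n
  · rw [mem_monomialIdealIn, AlgEquiv.apply_symm_apply, mem_ideal_span_monomial_image]
    intro h
    obtain ⟨u, hu, huv⟩ := h v (by classical simp [coeff_monomial])
    exact hvs u hu huv
  · intro r
    rw [mem_monomialIdealIn, mem_monomialIdealIn, map_mul, AlgEquiv.apply_symm_apply,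
      mul_monomial_mem_span_iff, mem_ideal_span_monomial_image]
    exact forall₂_congr fun w _ => hcolon w

/-- A new variable is a nonzerodivisor modulo the ideal of the earlier ones, so that ideal is its
own colon and the induction hypothesis serves for both inputs. -/
theorem hasLinearSyzygies_variables [Finite σ]
    (hψ : ∀ f n, f.IsHomogeneous n → (ψ f).IsHomogeneous n)
    (hψ' : ∀ f n, f.IsHomogeneous n → (ψ.symm f).IsHomogeneous n)
    (V : Set σ) :
    ∃ h, HasLinearSyzygies (homogeneousSubmodule σ k) h (MvPolynomial σ k)
      (forms (monomialIdealIn ψ ((fun i => Finsupp.single i 1) '' V)) 1) := by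
  induction V, V.toFinite using Set.Finite.induction_on with
  | empty =>
    refine ⟨0, fun e => (AddSubgroup.eq_bot_iff_forall _).2 fun f hf => ?_⟩
    simpa [monomialIdealIn] using hf.1
  | @insert j V hj _ ih =>
    obtain ⟨h, ih⟩ := ih
    refine ⟨h + 1, ?_⟩
    rw [Set.image_insert_eq]
    refine HasLinearSyzygies.insert_monomial hψ hψ' (by simp) ?_ ?_ ih ih
    · rintro _ ⟨i, hi, rfl⟩ hle
      have hij : i ≠ j := fun h => hj (h ▸ hi)
      rw [Finsupp.single_le_iff, Finsupp.single_eq_of_ne hij] at hle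
      omega
    · intro w
      simp only [Set.exists_mem_image, Finsupp.single_le_iff, Finsupp.add_apply]
      refine exists_congr fun i => and_congr_right fun hi => ?_
      have hij : i ≠ j := fun h => hj (h ▸ hi)
      rw [Finsupp.single_eq_of_ne hij, add_zero]

theorem not_le_of_degree_eq {u v : σ →₀ ℕ} (h : u.degree = v.degree) (hne : u ≠ v) : ¬ u ≤ v := by
  intro hle
  obtain ⟨c, rfl⟩ := exists_add_of_le hle
  rw [map_add] at h
  have : c = 0 := (Finsupp.degree_eq_zero_iff c).1 (by omega)
  exact hne (by simp [this])

/-- An ideal generated by the bases of a discrete polymatroid has linear quotients, hence a linear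
resolution. -/
theorem hasLinearSyzygies_polymatroid [Finite σ]
    (hψ : ∀ f n, f.IsHomogeneous n → (ψ f).IsHomogeneous n)
    (hψ' : ∀ f n, f.IsHomogeneous n → (ψ.symm f).IsHomogeneous n)
    {d : ℕ} (D : Finset (σ →₀ ℕ))
    (hdeg : ∀ a ∈ D, a.degree = d)
    (hexch : ∀ a ∈ D, ∀ b ∈ D, ∀ i, b i < a i →
      ∃ j, a j < b j ∧ a - Finsupp.single i 1 + Finsupp.single j 1 ∈ D) :
    ∃ h, HasLinearSyzygies (homogeneousSubmodule σ k) h (MvPolynomial σ k)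
      (forms (monomialIdealIn ψ (D : Set (σ →₀ ℕ))) d) := by
  classical
  let _ : LinearOrder σ := IsWellOrder.linearOrder WellOrderingRel
  -- Induction over the initial segments of `D` in the lexicographic order of an arbitrary
  -- well-order on the variables.
  suffices H : ∀ S : Finset (σ →₀ ℕ), S ⊆ D →
      (∀ u ∈ S, ∀ y ∈ D, toLex y < toLex u → y ∈ S) →
      ∃ h, HasLinearSyzygies (homogeneousSubmodule σ k) h (MvPolynomial σ k)
        (forms (monomialIdealIn ψ (S : Set (σ →₀ ℕ))) d) from
    H D le_rfl fun _ _ y hy _ => hy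
  intro S
  induction S using Finset.induction_on_max_value (f := fun u : σ →₀ ℕ => toLex u) with
  | empty =>
    intro _ _
    refine ⟨0, fun e => (AddSubgroup.eq_bot_iff_forall _).2 fun f hf => ?_⟩
    simpa [monomialIdealIn] using hf.1
  | insert v s hvs hmax ih =>
    intro hsub hlow
    have hlt : ∀ u ∈ s, toLex u < toLex v := fun u hu =>
      lt_of_le_of_ne (hmax u hu) fun h => hvs (toLex.injective h ▸ hu)
    have hsD : s ⊆ D := (Finset.subset_insert v s).trans hsub
    have hvD : v ∈ D := hsub (Finset.mem_insert_self v s)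
    have hs : ∀ y ∈ D, toLex y < toLex v → y ∈ s := fun y hy hyv =>
      (Finset.mem_insert.1 (hlow v (Finset.mem_insert_self v s) y hy hyv)).resolve_left
        fun h => hyv.ne (by rw [h])
    obtain ⟨h₁, ih⟩ := ih hsD fun u hu y hy hyu => hs y hy (hyu.trans (hlt u hu))
    obtain ⟨h₂, hvar⟩ := hasLinearSyzygies_variables hψ hψ'
      {j | ∃ u ∈ s, u ≤ v + Finsupp.single j 1}
    refine ⟨max h₁ h₂ + 1, ?_⟩
    rw [Finset.coe_insert]
    refine HasLinearSyzygies.insert_monomial hψ hψ' (hdeg v hvD) ?_ ?_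
      (ih.mono (le_max_left _ _)) (hvar.mono (le_max_right _ _))
    · intro u hu
      exact not_le_of_degree_eq ((hdeg u (hsD hu)).trans (hdeg v hvD).symm)
        fun h => hvs (h ▸ hu)
    · intro w
      simp only [Set.exists_mem_image, Finsupp.single_le_iff]
      constructor
      · rintro ⟨u, hu, huw⟩
        -- At the first index `i` where `u` and `v` differ, exchange trades `i` for a `j` with `v j
        -- < u j`. Agreement before `i` forces `i < j`, so `v - e_i + e_j` is lexicographically
        -- smaller than `v`, is already present, and divides `v + e_j`. Finally `u ≤ w + v` and `v j
        -- < u j` give `1 ≤ w j`.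
        obtain ⟨i, hi, hi'⟩ := Finsupp.Lex.lt_iff.1 (hlt u hu)
        obtain ⟨j, hj, hj'⟩ := hexch v hvD u (hsD hu) i hi'
        have hij : i < j := by
          by_contra hle
          rcases (not_lt.1 hle).lt_or_eq with h | rfl
          · exact hj.ne' (hi j h)
          · exact absurd hi' hj.not_gt
        refine ⟨j, ⟨_, hs _ hj' (Finsupp.Lex.lt_iff.2 ⟨i, fun l hl => ?_, ?_⟩),
          add_le_add_left tsub_le_self _⟩, ?_⟩
        · simp [Finsupp.single_eq_of_ne hl.ne, Finsupp.single_eq_of_ne (hl.trans hij).ne]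
        · have hpos : 0 < v i := (Nat.zero_le _).trans_lt hi'
          simp [Finsupp.single_eq_of_ne hij.ne, hpos]
        · have := huw j
          simp only [Finsupp.add_apply] at this
          omega
      · rintro ⟨j, ⟨u, hu, huv⟩, hj⟩
        refine ⟨u, hu, huv.trans ?_⟩
        rw [add_comm]
        exact add_le_add_left (Finsupp.single_le_iff.2 hj) _

end MonomialIdeals

/-! ### Powers of ideals generated by variables -/

section PowersOfVariables

open MvPolynomial

variable {σ k : Type*} [Field k]

/-- Each factor of a product contributes at least one to the degree in `V`; conversely, variables of
`V` can be split off a monomial one at a time. -/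
theorem mem_span_X_pow_iff {V : Finset σ} {a : ℕ} {f : MvPolynomial σ k} :
    f ∈ Ideal.span (X '' (V : Set σ)) ^ a ↔ ∀ w ∈ f.support, a ≤ ∑ v ∈ V, w v := by
  classical
  constructor
  · intro hf
    induction a generalizing f with
    | zero => simp
    | succ a ih =>
      rw [pow_succ] at hf
      refine Submodule.mul_induction_on hf (fun g hg h hh w hw => ?_) (fun g h hg hh w hw => ?_)
      · obtain ⟨u, hu, u', hu', rfl⟩ := Finset.mem_add.1 (support_mul g h hw)
        obtain ⟨i, hi, hi'⟩ := mem_ideal_span_X_image.1 hh u' hu'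
        have h1 := ih hg u hu
        have h2 : u' i ≤ ∑ v ∈ V, u' v := Finset.single_le_sum (fun _ _ => Nat.zero_le _) hi
        simp only [Finsupp.add_apply, Finset.sum_add_distrib]
        omega
      · rcases Finset.mem_union.1 (support_add hw) with h' | h'
        · exact hg w h'
        · exact hh w h'
  · intro hf
    have key : ∀ (a : ℕ) (w : σ →₀ ℕ), a ≤ ∑ v ∈ V, w v →
        monomial w (1 : k) ∈ Ideal.span (X '' (V : Set σ)) ^ a := by
      intro a
      induction a with
      | zero => intro w _; simp
      | succ a ih =>
        intro w hw
        obtain ⟨i, hi, hi'⟩ : ∃ i ∈ V, w i ≠ 0 := by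
          by_contra! h
          rw [Finset.sum_eq_zero h] at hw
          omega
        have hle : Finsupp.single i 1 ≤ w := Finsupp.single_le_iff.2 (Nat.one_le_iff_ne_zero.2 hi')
        have hsum : ∑ v ∈ V, Finsupp.single i 1 v = 1 := by
          rw [Finset.sum_eq_single_of_mem i hi fun b _ hb => Finsupp.single_eq_of_ne hb]
          simp
        have hsplit : ∑ v ∈ V, (w - Finsupp.single i 1 : σ →₀ ℕ) v + 1 = ∑ v ∈ V, w v := by
          conv_rhs => rw [← tsub_add_cancel_of_le hle]
          simp only [Finsupp.add_apply, Finset.sum_add_distrib, hsum]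
        have := Ideal.mul_mem_mul (ih (w - Finsupp.single i 1) (by omega))
          (Ideal.subset_span (Set.mem_image_of_mem (X (R := k)) hi))
        rwa [X, monomial_mul, tsub_add_cancel_of_le hle, one_mul, ← pow_succ] at this
    rw [f.as_sum]
    refine sum_mem fun w hw => ?_
    have := Ideal.mul_mem_left _ (C (coeff w f)) (key a w (hf w hw))
    rwa [C_mul_monomial, mul_one] at this

end PowersOfVariables

/-! ### The exchange property -/

section Exchange

variable {σ ι : Type*} [Fintype σ]

theorem degree_sub_single_add_single {σ : Type*} {w : σ →₀ ℕ} {i j : σ} (hi : 0 < w i) :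
    (w - Finsupp.single i 1 + Finsupp.single j 1).degree = w.degree := by
  have hle : Finsupp.single i 1 ≤ w := Finsupp.single_le_iff.2 hi
  conv_rhs => rw [← tsub_add_cancel_of_le hle]
  simp

/-- The exchange property for the monomials of degree `d` whose degree outside of each of several
disjoint blocks of variables is bounded below. -/
theorem exists_exchange [DecidableEq σ] {κ : Type*} [DecidableEq κ] (c : σ → κ) (τ : ι → κ)
    (a : ι → ℕ) {u w : σ →₀ ℕ} (hdeg : u.degree = w.degree)
    (hu : ∀ t, a t ≤ ∑ v with c v ≠ τ t, u v) (hw : ∀ t, a t ≤ ∑ v with c v ≠ τ t, w v)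
    {i : σ} (hi : w i < u i) :
    ∃ j, u j < w j ∧
      ∀ t, a t ≤ ∑ v with c v ≠ τ t, (u - Finsupp.single i 1 + Finsupp.single j 1 : σ →₀ ℕ) v := by
  have hpos : 0 < u i := by omega
  have hle : Finsupp.single i 1 ≤ u := Finsupp.single_le_iff.2 hpos
  have hsingle : ∀ (q : κ) (l : σ), ∑ v with c v ≠ q, Finsupp.single l 1 v =
      if c l ≠ q then 1 else 0 := by
    intro q l
    rw [Finset.sum_filter]
    rw [Finset.sum_eq_single l (fun b _ hb => by simp [Finsupp.single_eq_of_ne hb])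
      (fun h => absurd (Finset.mem_univ l) h)]
    simp
  have hnew : ∀ (q : κ) (j : σ),
      ∑ v with c v ≠ q, (u - Finsupp.single i 1 + Finsupp.single j 1 : σ →₀ ℕ) v +
        (if c i ≠ q then 1 else 0) =
      ∑ v with c v ≠ q, u v + (if c j ≠ q then 1 else 0) := by
    intro q j
    rw [← hsingle q i, ← hsingle q j, ← Finset.sum_add_distrib, ← Finset.sum_add_distrib]
    refine Finset.sum_congr rfl fun v _ => ?_
    have := DFunLike.congr_fun (tsub_add_cancel_of_le hle) v
    simp only [Finsupp.add_apply] at this ⊢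
    omega
  have hsplit : ∀ (q : κ) (x : σ →₀ ℕ),
      ∑ v with c v = q, x v + ∑ v with c v ≠ q, x v = x.degree := by
    intro q x
    rw [Finset.sum_filter_add_sum_filter_not, Finsupp.degree_eq_sum]
  -- An exchange within the block of `i` changes no block degree.
  by_cases hcase : ∃ j, c j = c i ∧ u j < w j
  · obtain ⟨j, hj, hj'⟩ := hcase
    refine ⟨j, hj', fun t => ?_⟩
    have h1 := hnew (τ t) j
    have h2 := hu t
    rw [hj] at h1
    omega
  · push Not at hcase
    -- Otherwise `u` dominates `w` on the block of `i`, strictly at `i`; since the total degrees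
    -- agree, some other block `q` has smaller degree in `u` than in `w`, and `j` is taken there.
    have hblock : ∑ v with c v = c i, w v < ∑ v with c v = c i, u v :=
      Finset.sum_lt_sum (fun v hv => hcase v (by simpa using hv)) ⟨i, by simp, hi⟩
    have h1 := hsplit (c i) u
    have h2 := hsplit (c i) w
    have hrest : ∑ v with c v ≠ c i, u v < ∑ v with c v ≠ c i, w v := by omega
    obtain ⟨q, hq, hlt⟩ : ∃ q, q ≠ c i ∧ ∑ v with c v = q, u v < ∑ v with c v = q, w v := by
      by_contra! hall
      refine absurd hrest (not_lt.2 ?_)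
      have hmaps : ∀ v ∈ Finset.univ.filter (fun v => c v ≠ c i),
          c v ∈ (Finset.univ.image c).erase (c i) := fun v hv => by simpa using hv
      rw [← Finset.sum_fiberwise_of_maps_to hmaps, ← Finset.sum_fiberwise_of_maps_to hmaps]
      refine Finset.sum_le_sum fun q hq => ?_
      have hq' : q ≠ c i := (Finset.mem_erase.1 hq).1
      have hf : (Finset.univ.filter fun v => c v ≠ c i).filter (fun v => c v = q) =
          Finset.univ.filter fun v => c v = q := by
        ext v
        simp only [Finset.mem_filter, Finset.mem_univ, true_and, and_iff_right_iff_imp]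
        rintro rfl
        exact hq'
      rw [hf]
      exact hall q hq'
    obtain ⟨j, hj, hj'⟩ := Finset.exists_lt_of_sum_lt hlt
    have hjq : c j = q := by simpa using hj
    refine ⟨j, hj', fun t => ?_⟩
    have h3 := hnew (τ t) j
    -- If `τ t = q`, the degree of `u` outside `q` strictly exceeds that of `w`, hence `a t`, and
    -- can afford to drop by one. Otherwise `j` adds one outside the block and `i` removes at most
    -- one.
    by_cases ht : τ t = q
    · have h4 := hsplit q u
      have h5 := hsplit q w
      have h6 := hw t
      rw [ht] at h3 h6 ⊢
      rw [if_pos hq.symm, if_neg (not_not.2 hjq)] at h3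
      omega
    · rw [if_pos (show c j ≠ τ t from fun h => ht (by rw [← h, hjq]))] at h3
      have h2 := hu t
      split_ifs at h3 <;> omega

end Exchange

/-! ### General position and linear independence -/

section GeneralPosition

variable {k : Type*} [Field k]

theorem exists_le_finrank_eq {V : Type*} [AddCommGroup V] [Module k V] [FiniteDimensional k V]
    (W : Submodule k V) {m : ℕ} (h1 : Module.finrank k W ≤ m) (h2 : m ≤ Module.finrank k V) :
    ∃ W', W ≤ W' ∧ Module.finrank k W' = m := by
  induction m, h1 using Nat.le_induction with
  | base => exact ⟨W, le_rfl, rfl⟩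
  | succ m _ ih =>
    obtain ⟨W', hle, hW'⟩ := ih (by omega)
    obtain ⟨v, hv⟩ : ∃ v, v ∉ W' := by
      by_contra! h
      have : W' = ⊤ := Submodule.eq_top_iff'.2 h
      rw [this, finrank_top] at hW'
      omega
    exact ⟨W' ⊔ Submodule.span k {v}, hle.trans le_sup_left, by
      rw [Submodule.finrank_sup_span_singleton hv, hW']⟩

/-- Dependent components in factor `i` would lie in a linear subspace of projective dimension `s -
1`. Its product with the full other factors contains all `s + 1` points, but at most `s` are
allowed. -/
theorem LinearGeneralPosition.linearIndependent {r : ℕ} {n : Fin r → ℕ} {s : ℕ}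
    (hs : ∀ i, s ≤ n i) {P : Fin (s + 1) → MultiProj k n} (hP : Function.Injective P)
    (hgen : LinearGeneralPosition (Set.range P)) (i : Fin r) :
    LinearIndependent k fun t => (P t i).rep := by
  classical
  by_contra hdep
  rw [linearIndependent_iff_card_le_finrank_span, Fintype.card_fin, not_le, Set.finrank] at hdep
  -- For `s = 0` the dimension `s - 1` makes no sense; a single representative is independent
  -- because it is nonzero.
  have hpos : 0 < s := by
    by_contra h0
    obtain rfl : s = 0 := by omega
    have hbot : Submodule.span k (Set.range fun t => (P t i).rep) = ⊥ :=
      Submodule.finrank_eq_zero.1 (by omega)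
    have hmem : (P 0 i).rep ∈ Submodule.span k (Set.range fun t => (P t i).rep) :=
      Submodule.subset_span ⟨0, rfl⟩
    rw [hbot, Submodule.mem_bot] at hmem
    exact (P 0 i).rep_nonzero hmem
  have hsi := hs i
  obtain ⟨W', hle, hW'⟩ := exists_le_finrank_eq
    (Submodule.span k (Set.range fun t => (P t i).rep)) (m := s) (by omega)
    (by rw [Module.finrank_fin_fun]; omega)
  have key := hgen (Function.update n i (s - 1))
    (fun j => if h : j = i then h ▸ W' else ⊤) ?_ ⟨i, by simp; omega⟩
  · have hall : {p | p ∈ Set.range P ∧ ∀ j, (p j).submodule ≤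
        if h : j = i then h ▸ W' else ⊤} = Set.range P := by
      refine Set.Subset.antisymm (fun p hp => hp.1) ?_
      rintro _ ⟨t, rfl⟩
      refine ⟨⟨t, rfl⟩, fun j => ?_⟩
      split_ifs with h
      · subst h
        rw [Projectivization.submodule_eq, Submodule.span_singleton_le_iff_mem]
        exact hle (Submodule.subset_span ⟨t, rfl⟩)
      · exact le_top
    rw [hall, ← Set.image_univ, hP.encard_image, Set.encard_univ, ENat.card_eq_coe_fintype_card,
      Fintype.card_fin, Nat.cast_le] at key
    have hinf : (⨅ j, Function.update n i (s - 1) j) ≤ s - 1 := by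
      have := ciInf_le (OrderBot.bddBelow (Set.range (Function.update n i (s - 1)))) i
      simpa using this
    omega
  · intro j
    by_cases h : j = i
    · subst h
      rw [dif_pos rfl, Function.update_self, hW']
      omega
    · rw [dif_neg h, Function.update_of_ne h, finrank_top, Module.finrank_fin_fun]

/-- Extend `v` to a basis, permute the index set so that `v t` sits at position `e t`, and use the
basis vectors as columns. -/
theorem exists_matrix_of_linearIndependent {m s : ℕ} {v : Fin s → Fin m → k}
    (hv : LinearIndependent k v) {e : Fin s → Fin m} (he : Function.Injective e) :
    ∃ B : Matrix.GeneralLinearGroup (Fin m) k, ∀ t,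
      (fun l => (B : Matrix (Fin m) (Fin m) k) l (e t)) = v t := by
  classical
  let b := Module.Basis.extend hv.linearIndepOn_id
  let ι (t : Fin s) : hv.linearIndepOn_id.extend (Set.subset_univ (Set.range v)) :=
    ⟨v t, hv.linearIndepOn_id.subset_extend _ ⟨t, rfl⟩⟩
  have hι : Function.Injective ι := fun t t' h => hv.injective (congrArg Subtype.val h)
  let e₀ := b.indexEquiv (Pi.basisFun k (Fin m))
  obtain ⟨π, hπ⟩ := Equiv.Perm.exists_extending_pair (fun t => e₀ (ι t)) e
    (e₀.injective.comp hι) he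
  let b' := b.reindex (e₀.trans π)
  refine ⟨⟨(Pi.basisFun k (Fin m)).toMatrix b', b'.toMatrix (Pi.basisFun k (Fin m)),
    Module.Basis.toMatrix_mul_toMatrix_flip _ _, Module.Basis.toMatrix_mul_toMatrix_flip _ _⟩,
    fun t => ?_⟩
  have h1 : b' (e t) = v t := by
    rw [Module.Basis.reindex_apply, (e₀.trans π).symm_apply_eq.2 (hπ t).symm,
      Module.Basis.extend_apply_self]
  ext l
  simp [Module.Basis.toMatrix_apply, h1]

end GeneralPosition

/-! ### Linear coordinate changes and the ideals of points -/

section CoordinateChange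

open MvPolynomial

variable {k : Type*} [Field k]

/-- The linear substitution `x_j ↦ ∑_l A_{j,l} x_l`. -/
noncomputable def linearSubst {m : ℕ} (A : Matrix (Fin m) (Fin m) k) :
    MvPolynomial (Fin m) k →ₐ[k] MvPolynomial (Fin m) k :=
  aeval fun j => ∑ l, C (A j l) * X l

theorem linearSubst_X {m : ℕ} (A : Matrix (Fin m) (Fin m) k) (j : Fin m) :
    linearSubst A (X j) = ∑ l, C (A j l) * X l := aeval_X _ _

theorem isHomogeneous_linearSubst {m : ℕ} (A : Matrix (Fin m) (Fin m) k)
    {f : MvPolynomial (Fin m) k} {d : ℕ} (hf : f.IsHomogeneous d) :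
    (linearSubst A f).IsHomogeneous d := by
  have := hf.aeval (fun j => ∑ l, C (A j l) * X l) (n := 1)
    fun j => IsHomogeneous.sum _ _ _ fun l _ => isHomogeneous_C_mul_X _ _
  rwa [one_mul] at this

theorem eval_linearSubst {m : ℕ} (A : Matrix (Fin m) (Fin m) k) (x : Fin m → k)
    (f : MvPolynomial (Fin m) k) : eval x (linearSubst A f) = eval (A.mulVec x) f := by
  have : (aeval x).comp (linearSubst A) = (aeval (A.mulVec x) : _ →ₐ[k] k) := by
    ext j
    simp [linearSubst_X, Matrix.mulVec, dotProduct]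
  have h := DFunLike.congr_fun this f
  simpa [aeval_eq_eval] using h

theorem linearSubst_comp {m : ℕ} {A A' : Matrix (Fin m) (Fin m) k} (h : A' * A = 1)
    (f : MvPolynomial (Fin m) k) : linearSubst A (linearSubst A' f) = f := by
  have : (linearSubst A).comp (linearSubst A') = AlgHom.id k _ := by
    ext1 j
    simp only [AlgHom.comp_apply, linearSubst_X, map_sum, map_mul, algHom_C, AlgHom.id_apply,
      Finset.mul_sum, algebraMap_eq]
    rw [Finset.sum_comm]
    simp only [← mul_assoc, ← C_mul, ← Finset.sum_mul, ← map_sum, ← Matrix.mul_apply, h]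
    simp [Matrix.one_apply]
  exact DFunLike.congr_fun this f

theorem eval_smul_of_isHomogeneous {σ : Type*} [Fintype σ] {f : MvPolynomial σ k} {d : ℕ}
    (hf : f.IsHomogeneous d) (c : k) (x : σ → k) : eval (c • x) f = c ^ d * eval x f := by
  rw [eval_eq', eval_eq', Finset.mul_sum]
  refine Finset.sum_congr rfl fun w hw => ?_
  have hd : ∑ i, w i = d := by
    rw [← Finsupp.degree_eq_sum]
    by_contra h
    exact mem_support_iff.1 hw (hf.coeff_eq_zero h)
  simp only [Pi.smul_apply, smul_eq_mul, mul_pow, Finset.prod_mul_distrib,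
    Finset.prod_pow_eq_pow_sum, hd]
  ring

theorem eval_single_of_isHomogeneous {σ : Type*} [Fintype σ] [DecidableEq σ]
    {f : MvPolynomial σ k} {d : ℕ} (hf : f.IsHomogeneous d) (i : σ) :
    eval (Pi.single i 1) f = coeff (Finsupp.single i d) f := by
  rw [eval_eq', Finset.sum_eq_single (Finsupp.single i d)]
  · rw [Finset.prod_eq_one, mul_one]
    intro j _
    by_cases h : j = i
    · subst h; simp
    · simp [Finsupp.single_eq_of_ne h]
  · intro w hw hne
    have hd : w.degree = d := by
      by_contra h
      exact mem_support_iff.1 hw (hf.coeff_eq_zero h)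
    obtain ⟨j, hj, hj'⟩ : ∃ j, j ≠ i ∧ w j ≠ 0 := by
      by_contra! h
      apply hne
      have hw' : w = Finsupp.single i (w i) := by
        ext j
        by_cases hji : j = i
        · subst hji; simp
        · rw [h j hji, Finsupp.single_eq_of_ne hji]
      rw [hw', Finsupp.degree_single] at hd
      rw [hw', hd]
    rw [Finset.prod_eq_zero (Finset.mem_univ j), mul_zero]
    rw [Pi.single_eq_of_ne hj, zero_pow hj']
  · intro h
    rw [notMem_support_iff.1 h, zero_mul]

/-- The substitution turns evaluation at `p` into evaluation at the vertex `τ`, up to a nonzero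
scalar. On forms of degree `d` this reads off the coefficient of `x_τ ^ d`, so a form vanishes there
iff each of its monomials involves another variable. -/
theorem map_projPointIdeal {m : ℕ} (p : Proj k m)
    {A A' : Matrix (Fin (m + 1)) (Fin (m + 1)) k} (h : A' * A = 1)
    {τ : Fin (m + 1)} (hp : p.submodule = Submodule.span k {fun l => A l τ}) :
    (projPointIdeal p).map (linearSubst A) = Ideal.span (X '' {j | j ≠ τ}) := by
  classical
  have hcol : A.mulVec (Pi.single τ 1) = fun l => A l τ := by
    ext l; simp
  obtain ⟨c, hc⟩ : ∃ c : k, c • (fun l => A l τ) = p.rep := by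
    rw [← Submodule.mem_span_singleton, ← hp, Projectivization.submodule_eq]
    exact Submodule.mem_span_singleton_self _
  have hc0 : c ≠ 0 := by
    rintro rfl
    exact p.rep_nonzero (by rw [← hc, zero_smul])
  apply le_antisymm
  · rw [projPointIdeal, Ideal.map_span, Ideal.span_le]
    rintro _ ⟨f, ⟨⟨d, hf⟩, hf0⟩, rfl⟩
    rw [SetLike.mem_coe, mem_ideal_span_X_image]
    intro w hw
    by_contra! hz
    have hhom := isHomogeneous_linearSubst A hf
    have hcoeff : coeff (Finsupp.single τ d) (linearSubst A f) = 0 := by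
      rw [← eval_single_of_isHomogeneous hhom, eval_linearSubst, hcol]
      rw [← hc, eval_smul_of_isHomogeneous hf] at hf0
      exact (mul_eq_zero.1 hf0).resolve_left (pow_ne_zero _ hc0)
    have hw' : w = Finsupp.single τ (w τ) := by
      ext j
      by_cases hj : j = τ
      · subst hj; simp
      · rw [hz j hj, Finsupp.single_eq_of_ne hj]
    have hd : w.degree = d := by
      by_contra hne
      exact mem_support_iff.1 hw (hhom.coeff_eq_zero hne)
    rw [hw', Finsupp.degree_single] at hd
    rw [hd] at hw'
    rw [hw'] at hw
    exact mem_support_iff.1 hw hcoeff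
  · rw [Ideal.span_le]
    rintro _ ⟨j, hj, rfl⟩
    -- `X j` is the image of a linear form obtained by the inverse substitution, which vanishes at
    -- `p`.
    rw [SetLike.mem_coe, ← linearSubst_comp h (X j)]
    refine Ideal.mem_map_of_mem _ (Ideal.subset_span ⟨⟨1, ?_⟩, ?_⟩)
    · exact isHomogeneous_linearSubst _ (isHomogeneous_X _ _)
    · rw [eval_linearSubst, ← hc, eval_X, Matrix.mulVec_smul, ← hcol, Matrix.mulVec_mulVec, h,
        Matrix.one_mulVec, Pi.smul_apply, Pi.single_eq_of_ne hj, smul_zero]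

variable {r : ℕ} {n : Fin r → ℕ}

theorem coordChange_rename (B : ∀ i, Matrix (Fin (n i + 1)) (Fin (n i + 1)) k) (i : Fin r)
    (f : MvPolynomial (Fin (n i + 1)) k) :
    coordChange B (rename (fun j => (⟨i, j⟩ : Var n)) f) =
      rename (fun j => (⟨i, j⟩ : Var n)) (linearSubst (B i) f) := by
  have : (coordChange B).comp (rename fun j => (⟨i, j⟩ : Var n)) =
      (rename fun j => (⟨i, j⟩ : Var n)).comp (linearSubst (B i)) := by
    ext1 j
    simp [coordChange, linearSubst_X]
  exact DFunLike.congr_fun this f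

theorem isHomogeneous_coordChange (B : ∀ i, Matrix (Fin (n i + 1)) (Fin (n i + 1)) k)
    {f : MvPolynomial (Var n) k} {d : ℕ} (hf : f.IsHomogeneous d) :
    (coordChange B f).IsHomogeneous d := by
  have := hf.aeval (fun v => ∑ l, C (B v.1 v.2 l) * X (⟨v.1, l⟩ : Var n)) (n := 1)
    fun j => IsHomogeneous.sum _ _ _ fun l _ => isHomogeneous_C_mul_X _ _
  rwa [one_mul] at this

theorem coordChange_comp {B B' : ∀ i, Matrix (Fin (n i + 1)) (Fin (n i + 1)) k}
    (h : ∀ i, B' i * B i = 1) :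
    (coordChange B).comp (coordChange B') = AlgHom.id k (MvPolynomial (Var n) k) := by
  ext1 ⟨i, j⟩
  have := coordChange_rename B' i (X j)
  rw [rename_X] at this
  rw [AlgHom.comp_apply, this, coordChange_rename, linearSubst_comp (h i), rename_X,
    AlgHom.id_apply]

/-- An invertible linear change of coordinates in each block of variables. -/
noncomputable def coordEquiv (B : ∀ i, Matrix.GeneralLinearGroup (Fin (n i + 1)) k) :
    MvPolynomial (Var n) k ≃ₐ[k] MvPolynomial (Var n) k :=
  AlgEquiv.ofAlgHom (coordChange fun i => (B i).1) (coordChange fun i => (B i).2)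
    (coordChange_comp fun i => (B i).inv_val) (coordChange_comp fun i => (B i).val_inv)

theorem isHomogeneous_coordEquiv (B : ∀ i, Matrix.GeneralLinearGroup (Fin (n i + 1)) k)
    (f : MvPolynomial (Var n) k) (d : ℕ) (hf : f.IsHomogeneous d) :
    (coordEquiv B f).IsHomogeneous d :=
  isHomogeneous_coordChange (fun i => (B i).1) hf

theorem isHomogeneous_coordEquiv_symm (B : ∀ i, Matrix.GeneralLinearGroup (Fin (n i + 1)) k)
    (f : MvPolynomial (Var n) k) (d : ℕ) (hf : f.IsHomogeneous d) :
    ((coordEquiv B).symm f).IsHomogeneous d :=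
  isHomogeneous_coordChange (fun i => (B i).2) hf

theorem map_pointIdeal (P : MultiProj k n) (B : ∀ i, Matrix.GeneralLinearGroup (Fin (n i + 1)) k)
    {τ : ∀ i, Fin (n i + 1)}
    (hP : ∀ i, (P i).submodule = Submodule.span k {fun l => (B i).1 l (τ i)}) :
    (pointIdeal P).map (coordEquiv B) = Ideal.span (X '' {v : Var n | v.2 ≠ τ v.1}) := by
  have hi : ∀ i, ((projPointIdeal (P i)).map
      (rename (R := k) (fun j => (⟨i, j⟩ : Var n)))).map (coordEquiv B) =
      Ideal.span (X '' ((fun j => (⟨i, j⟩ : Var n)) '' {j | j ≠ τ i})) := by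
    intro i
    let ρ : MvPolynomial (Fin (n i + 1)) k →+* MvPolynomial (Var n) k :=
      (rename fun j => (⟨i, j⟩ : Var n) : _ →ₐ[k] _).toRingHom
    have hcomp : (coordEquiv B : MvPolynomial (Var n) k →+* MvPolynomial (Var n) k).comp ρ =
        ρ.comp (linearSubst (B i).1).toRingHom :=
      RingHom.ext fun f => coordChange_rename (fun i => (B i).1) i f
    have hmap : ((projPointIdeal (P i)).map
        (rename (R := k) (fun j => (⟨i, j⟩ : Var n)))).map (coordEquiv B) =
        ((projPointIdeal (P i)).map (linearSubst (B i).1)).map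
          (rename (R := k) (fun j => (⟨i, j⟩ : Var n))) := by
      have h1 := Ideal.map_map (I := projPointIdeal (P i)) ρ
        (coordEquiv B : MvPolynomial (Var n) k →+* MvPolynomial (Var n) k)
      rw [hcomp, ← Ideal.map_map] at h1
      exact h1
    rw [hmap, map_projPointIdeal (P i) (B i).inv_val (hP i), Ideal.map_span,
      Set.image_image, Set.image_image]
    simp only [rename_X]
  rw [pointIdeal, Ideal.map_iSup]
  simp only [hi]
  rw [← Ideal.span_iUnion, ← Set.image_iUnion]
  congr 2
  ext ⟨i, j⟩
  simp only [Set.mem_iUnion, Set.mem_image, Set.mem_ofPred_eq]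
  constructor
  · rintro ⟨i', j', hj, h⟩
    cases h
    exact hj
  · exact fun h => ⟨i, j, h, rfl⟩

/-- One coordinate change makes all point ideals monomial simultaneously, so membership in the
intersection of their powers is tested monomial by monomial. -/
theorem mem_fatIdeal_iff {s : ℕ} {P : Fin (s + 1) → MultiProj k n}
    {B : ∀ i, Matrix.GeneralLinearGroup (Fin (n i + 1)) k} {τ : Fin (s + 1) → ∀ i, Fin (n i + 1)}
    (hP : ∀ t i, (P t i).submodule = Submodule.span k {fun l => (B i).1 l (τ t i)})
    (a : Fin (s + 1) → ℕ) {f : MvPolynomial (Var n) k} :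
    f ∈ fatIdeal P a ↔ ∀ w ∈ (coordEquiv B f).support, ∀ t,
      a t ≤ ∑ v : Var n with v.2 ≠ τ t v.1, w v := by
  have ht : ∀ t, f ∈ pointIdeal (P t) ^ a t ↔ ∀ w ∈ (coordEquiv B f).support,
      a t ≤ ∑ v : Var n with v.2 ≠ τ t v.1, w v := by
    intro t
    rw [← mem_span_X_pow_iff, Finset.coe_filter_univ, ← map_pointIdeal (P t) B (hP t),
      ← Ideal.map_pow]
    constructor
    · exact Ideal.mem_map_of_mem _
    · intro h
      obtain ⟨g, hg, hgf⟩ := (Ideal.mem_map_of_equiv (coordEquiv B) _).1 h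
      rwa [← (coordEquiv B).injective hgf]
  rw [fatIdeal, Ideal.mem_iInf]
  simp only [ht]
  exact ⟨fun h w hw t => h t w hw, fun h t w hw => h w hw t⟩

end CoordinateChange

/-! ### Polymatroidality and linearity of the components of the fat point ideal -/

section FatIdeals

open MvPolynomial

variable {k : Type*} [Field k]

/-- A minimal generator is divisible by a monomial from `D`, hence equal to it; degrees and exchange
are then inherited from `D`. -/
theorem isPolymatroidal_span_monomial {σ : Type*} {D : Set (σ →₀ ℕ)} {d : ℕ}
    (hdeg : ∀ a ∈ D, a.degree = d)
    (hexch : ∀ a ∈ D, ∀ b ∈ D, ∀ i, b i < a i →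
      ∃ j, a j < b j ∧ a - Finsupp.single i 1 + Finsupp.single j 1 ∈ D) :
    IsPolymatroidal (Ideal.span ((fun a => monomial a (1 : k)) '' D)) := by
  classical
  have hmem : ∀ w, monomial w (1 : k) ∈ Ideal.span ((fun a => monomial a (1 : k)) '' D) ↔
      ∃ u ∈ D, u ≤ w := by
    intro w
    rw [mem_ideal_span_monomial_image]
    simp [coeff_monomial]
  have hgen : ∀ w, IsMinimalGenerator (Ideal.span ((fun a => monomial a (1 : k)) '' D)) w →
      w ∈ D := by
    rintro w ⟨hw, hmin⟩
    obtain ⟨u, hu, huw⟩ := (hmem w).1 hw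
    rwa [le_antisymm (hmin ((hmem u).2 ⟨u, hu, le_rfl⟩) huw) huw]
  refine ⟨⟨D, rfl⟩, ⟨d, fun a ha => hdeg a (hgen a ha)⟩, fun a b ha hb i hi => ?_⟩
  obtain ⟨j, hj, hj'⟩ := hexch a (hgen a ha) b (hgen b hb) i hi
  exact ⟨j, hj, (hmem _).2 ⟨_, hj', le_rfl⟩⟩

theorem component_component {σ : Type*} (I : Ideal (MvPolynomial σ k)) (d : ℕ) :
    component (component I d) d = component I d := by
  have hle : ∀ J : Ideal (MvPolynomial σ k), component J d ≤ J := fun J =>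
    Ideal.span_le.2 fun f hf => hf.1
  exact le_antisymm (hle _) (Ideal.span_mono fun f hf => ⟨Ideal.subset_span hf, hf.2⟩)

variable {r : ℕ} {n : Fin r → ℕ} {s : ℕ}

/-- The exponents of the monomials of degree `d` that vanish to order `a t` at the `t`-th
coordinate point for all `t`. -/
def fatExponents (n : Fin r → ℕ) (a : Fin (s + 1) → ℕ) (d : ℕ) : Set (Var n →₀ ℕ) :=
  {w | w.degree = d ∧ ∀ t, a t ≤ ∑ v : Var n with v.2.val ≠ t.val, w v}

theorem exists_exchange_fatExponents {a : Fin (s + 1) → ℕ} {d : ℕ} {u w : Var n →₀ ℕ}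
    (hu : u ∈ fatExponents n a d) (hw : w ∈ fatExponents n a d) {i : Var n} (hi : w i < u i) :
    ∃ j, u j < w j ∧ u - Finsupp.single i 1 + Finsupp.single j 1 ∈ fatExponents n a d := by
  -- The blocks are indexed by the second index as a natural number, which is comparable across
  -- factors of different dimension.
  obtain ⟨j, hj, hj'⟩ := exists_exchange (fun v : Var n => v.2.val) (fun t => t.val) a
    (hu.1.trans hw.1.symm) hu.2 hw.2 hi
  exact ⟨j, hj, (degree_sub_single_add_single (by omega)).trans hu.1, hj'⟩

variable {P : Fin (s + 1) → MultiProj k n} {a : Fin (s + 1) → ℕ}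
  {B : ∀ i, Matrix.GeneralLinearGroup (Fin (n i + 1)) k}

theorem mem_fatIdeal_iff_of_vertices (hs : ∀ i, s ≤ n i)
    (hB : ∀ t i, (P t i).submodule = Submodule.span k
        {fun l => (B i : Matrix (Fin (n i + 1)) (Fin (n i + 1)) k) l
          (Fin.castLE (Nat.succ_le_succ (hs i)) t)}) {f : MvPolynomial (Var n) k} :
    f ∈ fatIdeal P a ↔ ∀ w ∈ (coordEquiv B f).support, ∀ t,
      a t ≤ ∑ v : Var n with v.2.val ≠ t.val, w v := by
  rw [mem_fatIdeal_iff (τ := fun t i => Fin.castLE (Nat.succ_le_succ (hs i)) t) hB]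
  simp only [ne_eq, Fin.ext_iff, Fin.val_castLE]

theorem component_fatIdeal (hs : ∀ i, s ≤ n i)
    (hB : ∀ t i, (P t i).submodule = Submodule.span k
        {fun l => (B i : Matrix (Fin (n i + 1)) (Fin (n i + 1)) k) l
          (Fin.castLE (Nat.succ_le_succ (hs i)) t)}) (d : ℕ) :
    component (fatIdeal P a) d = monomialIdealIn (coordEquiv B) (fatExponents n a d) := by
  classical
  apply le_antisymm
  · refine Ideal.span_le.2 fun f hf => ?_
    rw [SetLike.mem_coe, mem_monomialIdealIn, mem_ideal_span_monomial_image]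
    intro w hw
    refine ⟨w, ⟨?_, (mem_fatIdeal_iff_of_vertices hs hB).1 hf.1 w hw⟩, le_rfl⟩
    by_contra hne
    exact mem_support_iff.1 hw ((isHomogeneous_coordEquiv B _ _ hf.2).coeff_eq_zero hne)
  · refine Ideal.span_le.2 ?_
    rintro _ ⟨w, ⟨hwd, hw⟩, rfl⟩
    refine Ideal.subset_span ⟨(mem_fatIdeal_iff_of_vertices hs hB).2 fun u hu => ?_,
      isHomogeneous_coordEquiv_symm B _ _ (isHomogeneous_monomial _ hwd)⟩
    rw [AlgEquiv.apply_symm_apply] at hu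
    rwa [Finset.mem_singleton.1 (support_monomial_subset hu)]

attribute [local instance] MvPolynomial.gradedAlgebra in
theorem isHomogeneous_fatIdeal (hs : ∀ i, s ≤ n i)
    (hB : ∀ t i, (P t i).submodule = Submodule.span k
        {fun l => (B i : Matrix (Fin (n i + 1)) (Fin (n i + 1)) k) l
          (Fin.castLE (Nat.succ_le_succ (hs i)) t)}) :
    (fatIdeal P a).IsHomogeneous (homogeneousSubmodule (Var n) k) := by
  classical
  intro e f hf
  change (decomposition.decompose' f e : MvPolynomial (Var n) k) ∈ _
  rw [decomposition.decompose'_apply]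
  rw [mem_fatIdeal_iff_of_vertices hs hB] at hf ⊢
  rw [← homogeneousComponent_algEquiv (isHomogeneous_coordEquiv B),
    support_homogeneousComponent]
  exact fun w hw => hf w (Finset.mem_filter.1 hw).1

theorem hasLinearResolution_component_fatIdeal (hs : ∀ i, s ≤ n i)
    (hB : ∀ t i, (P t i).submodule = Submodule.span k
        {fun l => (B i : Matrix (Fin (n i + 1)) (Fin (n i + 1)) k) l
          (Fin.castLE (Nat.succ_le_succ (hs i)) t)}) (d : ℕ) :
    HasLinearResolution (component (fatIdeal P a) d) d := by
  have hfin : (fatExponents n a d).Finite :=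
    (Finsupp.finite_of_degree_eq d).subset fun w hw => hw.1
  obtain ⟨h, hlin⟩ := hasLinearSyzygies_polymatroid (ψ := coordEquiv B)
    (isHomogeneous_coordEquiv B) (isHomogeneous_coordEquiv_symm B)
    (d := d) hfin.toFinset (fun w hw => (hfin.mem_toFinset.1 hw).1) (fun u hu w hw i hi => by
      rw [hfin.mem_toFinset] at hu hw
      simpa only [hfin.mem_toFinset] using exists_exchange_fatExponents hu hw hi)
  rw [hfin.coe_toFinset, ← component_fatIdeal hs hB] at hlin
  exact hasLinearResolution_of_hasLinearSyzygies (component_component _ d)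
    (hlin.mono (Nat.le_succ h))

theorem map_coordChange_component_fatIdeal (hs : ∀ i, s ≤ n i)
    (hB : ∀ t i, (P t i).submodule = Submodule.span k
        {fun l => (B i : Matrix (Fin (n i + 1)) (Fin (n i + 1)) k) l
          (Fin.castLE (Nat.succ_le_succ (hs i)) t)}) (d : ℕ) :
    (component (fatIdeal P a) d).map
        (coordChange fun i => (B i : Matrix (Fin (n i + 1)) (Fin (n i + 1)) k)) =
      Ideal.span ((fun w => monomial w (1 : k)) '' fatExponents n a d) := by
  rw [component_fatIdeal hs hB, monomialIdealIn, Ideal.map_span, Set.image_image]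
  congr 1
  exact Set.image_congr fun w _ => (coordEquiv B).apply_symm_apply _

end FatIdeals

end FatPoints

theorem theorem6p9 {k : Type*} [Field k] {r : ℕ} (hr : 0 < r) (n : Fin r → ℕ) (s : ℕ)
    (hs : ∀ i, s ≤ n i)
    (P : Fin (s + 1) → FatPoints.MultiProj k n) (hP : Function.Injective P)
    (hgen : FatPoints.LinearGeneralPosition (Set.range P))
    (a : Fin (s + 1) → ℕ) (ha : ∀ t, 0 < a t) :
    (∃ B : ∀ i, Matrix.GeneralLinearGroup (Fin (n i + 1)) k,
      (∀ t i, (P t i).submodule = Submodule.span k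
        {fun l => (B i : Matrix (Fin (n i + 1)) (Fin (n i + 1)) k) l
          (Fin.castLE (Nat.succ_le_succ (hs i)) t)}) ∧
      ∀ d, FatPoints.IsPolymatroidal
        ((FatPoints.component (FatPoints.fatIdeal P a) d).map
          (FatPoints.coordChange fun i =>
            (B i : Matrix (Fin (n i + 1)) (Fin (n i + 1)) k)))) ∧
    FatPoints.IsComponentwiseLinear (FatPoints.fatIdeal P a) := by
  choose B hB using fun i => FatPoints.exists_matrix_of_linearIndependent
    (hgen.linearIndependent hs hP i)
    (Fin.castLE_injective (Nat.succ_le_succ (hs i)))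
  have hB' : ∀ t i, (P t i).submodule = Submodule.span k
      {fun l => (B i : Matrix (Fin (n i + 1)) (Fin (n i + 1)) k) l
        (Fin.castLE (Nat.succ_le_succ (hs i)) t)} := fun t i => by
    rw [hB i t, Projectivization.submodule_eq]
  refine ⟨⟨B, hB', fun d => ?_⟩, FatPoints.isHomogeneous_fatIdeal hs hB', fun d =>
    FatPoints.hasLinearResolution_component_fatIdeal hs hB' d⟩
  rw [FatPoints.map_coordChange_component_fatIdeal hs hB']
  exact FatPoints.isPolymatroidal_span_monomial (d := d) (fun w hw => hw.1)
    fun u hu w hw i hi => FatPoints.exists_exchange_fatExponents hu hw hi
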